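/- Let $T=S^1\times S^1$ be the two-dimensional torus, $I=[0,1]$, and let $P:T\times I\to T$ be the projection $P(x,t)=x$. For a continuous map $f:T\to T$ let $L(f)=\sum_{k=0}^{2}(-1)^k\operatorname{tr}\bigl(f_*:H_k(T;\mathbb Q)\to H_k(T;\mathbb Q)\bigr)$ be its Lefschetz number. For a continuous map $F:T\times I\to T$ write $F_t(x)=F(x,t)$ and $\mathrm{Fix}(F)=\{(x,t)\in T\times I: F(x,t)=x\}$. A smooth map $H:T\times I\to T$ is called transverse to $P$ if the graphs $\{(x,t,H(x,t))\}$ and $\{(x,t,x)\}$ intersect transversely in $T\times I\times T$, i.e. at every common point their tangent spaces together span the tangent space of $T\times I\times T$. Let $F:T\times I\to T$ be a continuous map with $L(F_t)=0$ for every $t\in I$. Then $F$ is homotopic (as a map $T\times I\to T$, not necessarily relative to $T\times\{0,1\}$) to a $C^\infty$ map $H:T\times I\to T$ such that $H$ is transverse to $P$, the set $\mathrm{Fix}(H)\cap(T\times\{t\})$ is finite for every $t\in I$, and $H$ has no fixed points on $T\times\{0,1\}$, i.e. $\mathrm{Fix}(H)\cap(T\times\{0,1\})=\emptyset$. -/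

import Mathlib

noncomputable section

open scoped Manifold ContDiff unitInterval

/-- The two-dimensional torus `S¹ × S¹`, with its product topology and product smooth structure. -/
abbrev Torus : Type := Circle × Circle

/-- The model with corners of the torus (a surface without boundary). -/
abbrev torusModel : ModelWithCorners ℝ (EuclideanSpace ℝ (Fin 1) × EuclideanSpace ℝ (Fin 1))
    (ModelProd (EuclideanSpace ℝ (Fin 1)) (EuclideanSpace ℝ (Fin 1))) :=
  (𝓡 1).prod (𝓡 1)

/-- The model with corners of `T × I` (a three-manifold with boundary `T × {0, 1}`). -/
abbrev torusIntervalModel : ModelWithCorners ℝ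
    ((EuclideanSpace ℝ (Fin 1) × EuclideanSpace ℝ (Fin 1)) × EuclideanSpace ℝ (Fin 1))
    (ModelProd (ModelProd (EuclideanSpace ℝ (Fin 1)) (EuclideanSpace ℝ (Fin 1)))
      (EuclideanHalfSpace 1)) :=
  torusModel.prod (𝓡∂ 1)

/-- Rational singular homology `H_k(X; ℚ)`. -/
abbrev rationalHomology (k : ℕ) (X : TopCat.{0}) : ModuleCat.{0} ℚ :=
  ((AlgebraicTopology.singularHomologyFunctor (ModuleCat.{0} ℚ) k).obj (ModuleCat.of ℚ ℚ)).obj X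

/-- The endomorphism of `H_k(X; ℚ)` induced by a continuous self-map of `X`. -/
def inducedOnHomology {X : Type} [TopologicalSpace X] (k : ℕ) (f : C(X, X)) :
    rationalHomology k (TopCat.of X) →ₗ[ℚ] rationalHomology k (TopCat.of X) :=
  (((AlgebraicTopology.singularHomologyFunctor (ModuleCat.{0} ℚ) k).obj
    (ModuleCat.of ℚ ℚ)).map (TopCat.ofHom f)).hom

/-- The Lefschetz number of a self-map of the torus: the alternating sum of the traces on
`H_0`, `H_1`, `H_2` with rational coefficients (the torus has dimension two). -/
def lefschetzNumber (f : C(Torus, Torus)) : ℚ :=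
  ∑ k ∈ Finset.range 3, (-1) ^ k * LinearMap.trace ℚ _ (inducedOnHomology k f)

/-- The projection `P : T × I → T`. -/
def torusProj : C(Torus × I, Torus) := ContinuousMap.fst

/-- The map `F_t : T → T`, `x ↦ F (x, t)`. -/
def timeSlice (F : C(Torus × I, Torus)) (t : I) : C(Torus, Torus) where
  toFun x := F (x, t)
  continuous_toFun := by fun_prop

/-- `Fix F`, the set of points `(x, t)` with `F (x, t) = x`. -/
def fixSet (F : C(Torus × I, Torus)) : Set (Torus × I) := {p | F p = torusProj p}

/-- Two smooth maps `f : A → Y`, `g : B → Y` are transverse: wherever `f a = g b`, the images of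
the two differentials together span the tangent space of `Y` at this point. -/
def SmoothTransverse
    {EA HA A EB HB B EY HY Y : Type*}
    [NormedAddCommGroup EA] [NormedSpace ℝ EA] [TopologicalSpace HA]
    [TopologicalSpace A] [ChartedSpace HA A] (IA : ModelWithCorners ℝ EA HA)
    [NormedAddCommGroup EB] [NormedSpace ℝ EB] [TopologicalSpace HB]
    [TopologicalSpace B] [ChartedSpace HB B] (IB : ModelWithCorners ℝ EB HB)
    [NormedAddCommGroup EY] [NormedSpace ℝ EY] [TopologicalSpace HY]
    [TopologicalSpace Y] [ChartedSpace HY Y] (IY : ModelWithCorners ℝ EY HY)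
    (f : A → Y) (g : B → Y) : Prop :=
  ContMDiff IA IY ∞ f ∧ ContMDiff IB IY ∞ g ∧
    ∀ a b, f a = g b →
      let Df : EA →L[ℝ] EY := mfderiv IA IY f a
      let Dg : EB →L[ℝ] EY := mfderiv IB IY g b
      Df.range ⊔ Dg.range = ⊤

/-- The graph map `T × I → T × I × T`, `(x, t) ↦ (x, t, F (x, t))`. -/
def graphMap (F : C(Torus × I, Torus)) (p : Torus × I) : (Torus × I) × Torus := (p, F p)

/-- `F` is transverse to `G`, as maps `T × I → T` between which one studies coincidences:
both are smooth and their graphs are transverse in `T × I × T`. -/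
def TransverseGraphs (F G : C(Torus × I, Torus)) : Prop :=
  SmoothTransverse torusIntervalModel torusIntervalModel (torusIntervalModel.prod torusModel)
    (graphMap F) (graphMap G)

end

/-! The homotopy may move the ends, so shrinking time deforms `F` to `F_0 ∘ P`. Lifting to the plane
shows that `F_0` is homotopic to every affine map `x ↦ A x + c` with one fixed integer matrix `A`
and arbitrary `c` (`exists_homotopic_torusAffine`). Its Lefschetz number is `1 - tr A + det A = det
(1 - A)` (`lefschetzNumber_torusAffine`), so `A` has an integral left eigenvector of eigenvalue `1`.
The corresponding character is multiplied by a constant under `x ↦ A x + c`; a `c` for which this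
constant is not `1` excludes fixed points (`exists_torusAffine_fixedPointFree`). Then `H = (A · + c)
∘ P` has empty fixed set and the remaining conditions are vacuous.

Most of the work is the traces on singular homology. Infinite cyclic coverings bound the Betti
numbers of the torus from above; explicit cocycles dual to explicit cycles show that the bounds are
attained and give the matrices of the induced maps. -/

open scoped Manifold ContDiff unitInterval
open CategoryTheory Limits Simplicial AlgebraicTopology

/-! ### Lifting to the plane and homotopy classes of torus maps -/

/-- Maps from a contractible space to the circle lift along the exponential. -/
theorem Circle.exists_exp_lift {X : Type*} [TopologicalSpace X] [ContractibleSpace X]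
    (f : C(X, Circle)) : ∃ g : C(X, ℝ), ∀ x, Circle.exp (g x) = f x := by
  obtain ⟨x₀, ⟨K⟩⟩ := id_nullhomotopic X
  obtain ⟨e, he⟩ := Circle.exp_surjective (f x₀)
  -- The contraction is run backwards: the homotopy starts at a constant map, which lifts to `e`,
  -- and ends at `f`.
  let G : C(I × X, Circle) := f.comp K.symm.toContinuousMap
  have h0 : ∀ a, G (0, a) = Circle.exp ((ContinuousMap.const X e) a) := by
    intro a
    simp [G, he]
  let L := Circle.isCoveringMap_exp.liftHomotopy G (ContinuousMap.const X e) h0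
  have hL := Circle.isCoveringMap_exp.liftHomotopy_lifts G (ContinuousMap.const X e) h0
  refine ⟨L.comp ⟨fun x => (1, x), by fun_prop⟩, fun x => ?_⟩
  have := congrFun hL (1, x)
  simpa [G, L] using this

/-- Two lifts of the same circle-valued map on a connected space differ by a multiple of `2π`. -/
theorem Circle.exp_lift_unique {X : Type*} [TopologicalSpace X] [PreconnectedSpace X]
    {g g' : X → ℝ} (hg : Continuous g) (hg' : Continuous g')
    (h : ∀ x, Circle.exp (g x) = Circle.exp (g' x)) :
    ∃ k : ℤ, ∀ x, g x = g' x + k * (2 * Real.pi) := by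
  rcases isEmpty_or_nonempty X with _ | ⟨⟨x₀⟩⟩
  · exact ⟨0, fun x => isEmptyElim x⟩
  obtain ⟨k, hk⟩ := Circle.exp_eq_exp.1 (h x₀)
  refine ⟨k, fun x => ?_⟩
  refine congrFun (Circle.isCoveringMap_exp.eq_of_comp_eq (g₁ := g)
    (g₂ := fun x => g' x + k * (2 * Real.pi)) hg (by fun_prop) ?_ x₀ hk) x
  funext y
  exact (h y).trans (Circle.exp_eq_exp.2 ⟨-k, by push_cast; ring⟩)

/-- The covering `ℝ × ℝ → S¹ × S¹`. -/
noncomputable def torusExp : C(ℝ × ℝ, Torus) := Circle.exp.prodMap Circle.exp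

/-- Lets doubly periodic functions on the plane descend to the torus. -/
theorem isQuotientMap_torusExp : Topology.IsQuotientMap torusExp := by
  have h := isLocalHomeomorph_circleExp.isOpenMap
  exact (h.prodMap h).isQuotientMap torusExp.continuous
    (Circle.exp_surjective.prodMap Circle.exp_surjective)

/-- A circle-valued map on the torus is a monomial times the exponential of a real function. -/
theorem exists_monomial_mul_exp (f : C(Torus, Circle)) :
    ∃ (a b : ℤ) (h : C(Torus, ℝ)), ∀ p, f p = p.1 ^ a * p.2 ^ b * Circle.exp (h p) := by
  obtain ⟨g, hg⟩ := Circle.exists_exp_lift (f.comp torusExp)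
  have hg' : ∀ x y : ℝ, Circle.exp (g (x, y)) = f (Circle.exp x, Circle.exp y) :=
    fun x y => hg (x, y)
  obtain ⟨a, ha⟩ := Circle.exp_lift_unique (g := fun p : ℝ × ℝ => g (p.1 + 2 * Real.pi, p.2))
    (g' := g) (by fun_prop) (by fun_prop) (by
      rintro ⟨x, y⟩
      rw [hg', hg', Circle.periodic_exp x])
  obtain ⟨b, hb⟩ := Circle.exp_lift_unique (g := fun p : ℝ × ℝ => g (p.1, p.2 + 2 * Real.pi))
    (g' := g) (by fun_prop) (by fun_prop) (by
      rintro ⟨x, y⟩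
      rw [hg', hg', Circle.periodic_exp y])
  -- The lift grows by `2πa` and `2πb` along the two periods; removing this linear part leaves a
  -- doubly periodic function.
  let k : C(ℝ × ℝ, ℝ) := ⟨fun p => g p - a * p.1 - b * p.2, by fun_prop⟩
  have k1 : ∀ y, Function.Periodic (fun x => k (x, y)) (2 * Real.pi) := by
    intro y x
    have := ha (x, y)
    simp only [k, ContinuousMap.coe_mk] at this ⊢
    rw [this]; ring
  have k2 : ∀ x, Function.Periodic (fun y => k (x, y)) (2 * Real.pi) := by
    intro x y
    have := hb (x, y)
    simp only [k, ContinuousMap.coe_mk] at this ⊢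
    rw [this]; ring
  have hfac : Function.FactorsThrough k torusExp := by
    rintro ⟨x, y⟩ ⟨x', y'⟩ hxy
    obtain ⟨h1, h2⟩ := Prod.ext_iff.1 hxy
    obtain ⟨m, hm⟩ := Circle.exp_eq_exp.1 h1
    obtain ⟨n, hn⟩ := Circle.exp_eq_exp.1 h2
    rw [hm, hn]
    exact ((k1 _).int_mul m x').trans ((k2 _).int_mul n y')
  refine ⟨a, b, isQuotientMap_torusExp.lift k hfac, fun p => ?_⟩
  obtain ⟨⟨x, y⟩, rfl⟩ := isQuotientMap_torusExp.surjective p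
  have : isQuotientMap_torusExp.lift k hfac (torusExp (x, y)) = k (x, y) :=
    congrArg (fun q : C(ℝ × ℝ, ℝ) => q (x, y)) (isQuotientMap_torusExp.lift_comp k hfac)
  rw [this]
  change f (Circle.exp x, Circle.exp y) = Circle.exp x ^ a * Circle.exp y ^ b * _
  rw [← hg', ← Circle.exp_intCast_mul, ← Circle.exp_intCast_mul, ← Circle.exp_add, ← Circle.exp_add]
  simp [k]

/-- The affine self-map `x ↦ A x + c` of the torus, in multiplicative notation. -/
noncomputable def torusAffine (A : Matrix (Fin 2) (Fin 2) ℤ) (c : Torus) : C(Torus, Torus) where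
  toFun p := (p.1 ^ A 0 0 * p.2 ^ A 0 1 * c.1, p.1 ^ A 1 0 * p.2 ^ A 1 1 * c.2)
  continuous_toFun := by fun_prop

/-- Every self-map of the torus is homotopic to an affine map with prescribed translation part. -/
theorem exists_homotopic_torusAffine (f : C(Torus, Torus)) :
    ∃ A : Matrix (Fin 2) (Fin 2) ℤ, ∀ c : Torus, f.Homotopic (torusAffine A c) := by
  obtain ⟨a, b, h, hf⟩ := exists_monomial_mul_exp (ContinuousMap.fst.comp f)
  obtain ⟨a', b', h', hf'⟩ := exists_monomial_mul_exp (ContinuousMap.snd.comp f)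
  refine ⟨!![a, b; a', b'], fun c => ?_⟩
  obtain ⟨e, he⟩ := Circle.exp_surjective c.1
  obtain ⟨e', he'⟩ := Circle.exp_surjective c.2
  -- The exponents are real, so they deform linearly to the constant logarithms `e`, `e'` of the
  -- coordinates of `c`.
  refine ⟨⟨⟨fun q => (q.2.1 ^ a * q.2.2 ^ b * Circle.exp ((1 - (q.1 : ℝ)) * h q.2 + q.1 * e),
    q.2.1 ^ a' * q.2.2 ^ b' * Circle.exp ((1 - (q.1 : ℝ)) * h' q.2 + q.1 * e')), ?_⟩,
    fun p => ?_, fun p => ?_⟩⟩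
  · fun_prop
  · have h1 := hf p
    have h2 := hf' p
    simp only [ContinuousMap.comp_apply, ContinuousMap.fst_apply, ContinuousMap.snd_apply] at h1 h2
    ext1 <;> simp [h1, h2]
  · simp [torusAffine, he, he']

/-! ### Homology of a free infinite cyclic quotient -/

/-- A discrete primitive of a function on `ℤ`. -/
theorem Int.exists_sub_succ_eq {A : Type*} [AddCommGroup A] (G : ℤ → A) :
    ∃ ρ : ℤ → A, ρ 0 = 0 ∧ ∀ k, ρ k - ρ (k + 1) = G k := by
  refine ⟨fun k => ∑ j ∈ Finset.Ico k 0, G j - ∑ j ∈ Finset.Ico 0 k, G j, by simp, fun k => ?_⟩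
  beta_reduce
  rcases lt_or_ge k 0 with hk | hk
  · rw [Finset.Ico_eq_empty_of_le hk.le, Finset.Ico_eq_empty_of_le (show k + 1 ≤ 0 by omega),
      ← Finset.sum_Ioo_add_eq_sum_Ico hk]
    have : Finset.Ico (k + 1) 0 = Finset.Ioo k 0 := by ext; simp
    rw [this]; simp
  · rw [Finset.Ico_eq_empty_of_le hk, Finset.Ico_eq_empty_of_le (show 0 ≤ k + 1 by omega)]
    have : Finset.Ico 0 (k + 1) = Finset.Icc 0 k := by ext; simp
    rw [this, ← Finset.sum_Ico_add_eq_sum_Icc hk]; simp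

/-- The rational coefficients. -/
noncomputable abbrev coeffQ : ModuleCat.{0} ℚ := ModuleCat.of ℚ ℚ

theorem finrank_le_of_exact {U V W : Type*} [AddCommGroup U] [AddCommGroup V] [AddCommGroup W]
    [Module ℚ U] [Module ℚ V] [Module ℚ W] [Module.Finite ℚ U] [Module.Finite ℚ W]
    (f : U →ₗ[ℚ] V) (g : V →ₗ[ℚ] W) (h : LinearMap.range f = LinearMap.ker g) :
    Module.Finite ℚ V ∧ Module.finrank ℚ V ≤ Module.finrank ℚ U + Module.finrank ℚ W := by
  have hk : Module.Finite ℚ (LinearMap.ker g) := h ▸ inferInstance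
  have hq : Module.Finite ℚ (V ⧸ LinearMap.ker g) :=
    Module.Finite.equiv g.quotKerEquivRange.symm
  have hV : Module.Finite ℚ V := Module.Finite.of_submodule_quotient (LinearMap.ker g)
  refine ⟨hV, ?_⟩
  rw [← LinearMap.finrank_range_add_finrank_ker g, ← h, add_comm]
  exact add_le_add (LinearMap.finrank_range_le f) (Submodule.finrank_le _)

namespace SSet

variable {Y X : SSet.{0}}

/-- The map on `n`-chains determined by its values on simplices. -/
noncomputable def chainDesc {n : ℕ} {T : ModuleCat.{0} ℚ} (w : Y _⦋n⦌ → (coeffQ ⟶ T)) :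
    (Y.chainComplex coeffQ).X n ⟶ T :=
  Cofan.IsColimit.desc (Y.isColimitChainComplexXCofan coeffQ n) w

@[simp]
theorem ι_chainDesc {n : ℕ} {T : ModuleCat.{0} ℚ} (w : Y _⦋n⦌ → (coeffQ ⟶ T)) (y : Y _⦋n⦌) :
    Y.ιChainComplex y ≫ chainDesc w = w y :=
  Cofan.IsColimit.fac (Y.isColimitChainComplexXCofan coeffQ n) w y

theorem ι_chainDesc_assoc {n : ℕ} {T U : ModuleCat.{0} ℚ} (w : Y _⦋n⦌ → (coeffQ ⟶ T))
    (y : Y _⦋n⦌) (h : T ⟶ U) : Y.ιChainComplex y ≫ chainDesc w ≫ h = w y ≫ h := by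
  rw [← Category.assoc, ι_chainDesc]

/-- The short complex of chain complexes attached to a map invariant under an endomorphism. -/
@[simps]
noncomputable def deckShortComplex (τ : Y ⟶ Y) (p : Y ⟶ X) (hp : τ ≫ p = p) :
    ShortComplex (ChainComplex (ModuleCat.{0} ℚ) ℕ) where
  X₁ := Y.chainComplex coeffQ
  X₂ := Y.chainComplex coeffQ
  X₃ := X.chainComplex coeffQ
  f := 𝟙 _ - chainComplexMap τ coeffQ
  g := chainComplexMap p coeffQ
  zero := by
    rw [Preadditive.sub_comp, Category.id_comp, sub_eq_zero]
    exact (congrArg (fun q => chainComplexMap q coeffQ) hp.symm).trans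
      (Functor.map_comp _ _ _)

/-- Through `e`, the `n`-chains of `Y` are a sum of copies of `ℚ[t, t⁻¹]` indexed by the simplices
of `X`, with `τ` acting as `t`; and `1 - t` is injective with cokernel `ℚ`. The splitting is only
degreewise and need not respect differentials. -/
theorem deckShortComplex_shortExact (τ : Y ⟶ Y) (p : Y ⟶ X) (hp : τ ≫ p = p)
    (e : ∀ n, X _⦋n⦌ × ℤ ≃ Y _⦋n⦌) (he : ∀ n x k, τ.app _ (e n (x, k)) = e n (x, k + 1))
    (hpe : ∀ n x k, p.app _ (e n (x, k)) = x) :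
    (deckShortComplex τ p hp).ShortExact := by
  apply HomologicalComplex.shortExact_of_degreewise_shortExact
  intro n
  choose ρ ρ0 hρ using fun x : X _⦋n⦌ =>
    Int.exists_sub_succ_eq (fun k => Y.ιChainComplex (R := coeffQ) (e n (x, k)))
  have hι : ∀ x k, Y.ιChainComplex (R := coeffQ) (e n (x, k)) ≫
      (𝟙 _ - chainComplexMap τ coeffQ : Y.chainComplex coeffQ ⟶ _).f n =
      Y.ιChainComplex (e n (x, k)) - Y.ιChainComplex (e n (x, k + 1)) := by
    intro x k
    rw [HomologicalComplex.sub_f_apply, Preadditive.comp_sub, ι_chainComplexMap_f, he]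
    simp
  have hρf : ∀ x k, ρ x k ≫ (𝟙 _ - chainComplexMap τ coeffQ : Y.chainComplex coeffQ ⟶ _).f n =
      Y.ιChainComplex (e n (x, k)) - Y.ιChainComplex (e n (x, 0)) := by
    intro x k
    have step : ∀ k, ρ x k ≫ (𝟙 _ - chainComplexMap τ coeffQ : Y.chainComplex coeffQ ⟶ _).f n =
      ρ x (k + 1) ≫ (𝟙 _ - chainComplexMap τ coeffQ : Y.chainComplex coeffQ ⟶ _).f n +
      (Y.ιChainComplex (e n (x, k)) - Y.ιChainComplex (e n (x, k + 1))) := by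
      intro k
      rw [← hι, ← Preadditive.add_comp, ← hρ x k, add_sub_cancel]
    induction k with
    | zero => simp [ρ0]
    | succ i ih =>
      have := step i
      rw [ih, ← sub_eq_iff_eq_add] at this
      rw [← this]; abel
    | pred i ih =>
      have := step (-i - 1)
      rw [this, sub_add_cancel, ih]; abel
  let u : Y.chainComplex coeffQ ⟶ Y.chainComplex coeffQ := 𝟙 _ - chainComplexMap τ coeffQ
  -- `r` is a left inverse of `1 - τ` given by discrete primitives; `s` lifts each simplex to sheet
  -- `0`.
  let r : (Y.chainComplex coeffQ).X n ⟶ (Y.chainComplex coeffQ).X n :=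
    chainDesc fun y => ρ ((e n).symm y).1 ((e n).symm y).2
  let s : (X.chainComplex coeffQ).X n ⟶ (Y.chainComplex coeffQ).X n :=
    chainDesc fun x => Y.ιChainComplex (e n (x, 0))
  have f_r : u.f n ≫ r = 𝟙 _ := by
    apply chainComplex_hom_ext
    intro y
    obtain ⟨⟨x, k⟩, rfl⟩ := (e n).surjective y
    rw [← Category.assoc, hι, Preadditive.sub_comp, ι_chainDesc, ι_chainDesc]
    simp [hρ]
  have s_g : s ≫ (chainComplexMap p coeffQ).f n = 𝟙 _ := by
    apply chainComplex_hom_ext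
    intro x
    rw [ι_chainDesc_assoc, ι_chainComplexMap_f, hpe, Category.comp_id]
  have id' : r ≫ u.f n + (chainComplexMap p coeffQ).f n ≫ s = 𝟙 _ := by
    apply chainComplex_hom_ext
    intro y
    obtain ⟨⟨x, k⟩, rfl⟩ := (e n).surjective y
    rw [Preadditive.comp_add, ι_chainDesc_assoc, ι_chainComplexMap_f_assoc, ι_chainDesc,
      hpe, Equiv.symm_apply_apply, hρf, sub_add_cancel, Category.comp_id]
  exact (ShortComplex.Splitting.mk (S := (deckShortComplex τ p hp).map
    (HomologicalComplex.eval _ _ n)) r s f_r s_g id').shortExact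

/-- Rational simplicial homology. -/
noncomputable abbrev ratHomology (Y : SSet.{0}) (n : ℕ) : ModuleCat.{0} ℚ := Y.homology coeffQ n

/-- Along a free infinite cyclic quotient, the dimension of homology is bounded by the
dimensions of the homology upstairs in two consecutive degrees. -/
theorem finrank_homology_le_of_deck (τ : Y ⟶ Y) (p : Y ⟶ X) (hp : τ ≫ p = p)
    (e : ∀ n, X _⦋n⦌ × ℤ ≃ Y _⦋n⦌) (he : ∀ n x k, τ.app _ (e n (x, k)) = e n (x, k + 1))
    (hpe : ∀ n x k, p.app _ (e n (x, k)) = x) (n : ℕ)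
    [Module.Finite ℚ (Y.ratHomology n)] [Module.Finite ℚ (Y.ratHomology (n + 1))] :
    Module.Finite ℚ (X.ratHomology (n + 1)) ∧
      Module.finrank ℚ (X.ratHomology (n + 1)) ≤
        Module.finrank ℚ (Y.ratHomology (n + 1)) + Module.finrank ℚ (Y.ratHomology n) := by
  have hS := deckShortComplex_shortExact τ p hp e he hpe
  -- Only exactness of `H_{n+1}(Y) → H_{n+1}(X) → H_n(Y)` is needed.
  have hex := hS.homology_exact₃ (n + 1) n rfl
  rw [ShortComplex.moduleCat_exact_iff_range_eq_ker] at hex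
  exact finrank_le_of_exact (V := X.ratHomology (n + 1))
    (HomologicalComplex.homologyMap (deckShortComplex τ p hp).g (n + 1)).hom
    (hS.δ (n + 1) n rfl).hom hex

end SSet

/-! ### Upper bounds for the Betti numbers of the torus -/

/-- The singular simplicial set of a space. -/
noncomputable abbrev sing (X : Type) [TopologicalSpace X] : SSet.{0} :=
  TopCat.toSSet.obj (TopCat.of X)

/-- The map of singular simplicial sets induced by a continuous map. -/
noncomputable abbrev singMap {X Y : Type} [TopologicalSpace X] [TopologicalSpace Y] (f : C(X, Y)) :
    sing X ⟶ sing Y := TopCat.toSSet.map (TopCat.ofHom f)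

/-- Singular simplices as continuous maps on the standard simplex. -/
noncomputable def singEquiv (X : Type) [TopologicalSpace X] (n : ℕ) :
    sing X _⦋n⦌ ≃ C(stdSimplex ℝ (Fin (n + 1)), X) :=
  (TopCat.of X).toSSetObjEquiv (Opposite.op ⦋n⦌)

section sing

variable {X Y Z : Type} [TopologicalSpace X] [TopologicalSpace Y] [TopologicalSpace Z]

theorem singEquiv_singMap (f : C(X, Y)) {n : ℕ} (x : sing X _⦋n⦌) :
    singEquiv Y n ((singMap f).app _ x) = f.comp (singEquiv X n x) := rfl

theorem singEquiv_δ {n : ℕ} (i : Fin (n + 2)) (x : sing X _⦋n + 1⦌) :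
    singEquiv X n ((sing X).δ i x) = (singEquiv X (n + 1) x).comp
      ⟨stdSimplex.map i.succAbove, stdSimplex.continuous_map _⟩ := rfl

theorem singMap_app_eq_iff (f : C(X, Y)) {n : ℕ} (x : sing X _⦋n⦌) (y : sing Y _⦋n⦌) :
    (singMap f).app _ x = y ↔ ∀ s, f (singEquiv X n x s) = singEquiv Y n y s := by
  rw [← (singEquiv Y n).apply_eq_iff_eq, singEquiv_singMap, ContinuousMap.ext_iff]
  rfl

instance (n : ℕ) : ContractibleSpace (stdSimplex ℝ (Fin (n + 1))) :=
  (convex_stdSimplex ℝ (Fin (n + 1))).contractibleSpace ⟨_, (stdSimplex.vertex 0).2⟩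

/-- A lift of a circle-valued map on a contractible space. -/
noncomputable def expLift [ContractibleSpace X] (f : C(X, Circle)) : C(X, ℝ) :=
  (Circle.exists_exp_lift f).choose

theorem exp_expLift [ContractibleSpace X] (f : C(X, Circle)) (x : X) :
    Circle.exp (expLift f x) = f x :=
  (Circle.exists_exp_lift f).choose_spec x

/-- The covering `ℝ × Z → S¹ × Z`. -/
noncomputable def expProd (Z : Type) [TopologicalSpace Z] : C(ℝ × Z, Circle × Z) :=
  Circle.exp.prodMap (ContinuousMap.id Z)

/-- The deck translation of `ℝ × Z`. -/
noncomputable def deckTranslation (Z : Type) [TopologicalSpace Z] : C(ℝ × Z, ℝ × Z) where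
  toFun p := (p.1 + 2 * Real.pi, p.2)
  continuous_toFun := by fun_prop

/-- The simplices of `ℝ × Z` are the simplices of `S¹ × Z` together with an integer. -/
noncomputable def deckSimplex (Z : Type) [TopologicalSpace Z] (n : ℕ)
    (q : sing (Circle × Z) _⦋n⦌ × ℤ) : sing (ℝ × Z) _⦋n⦌ :=
  (singEquiv _ n).symm
    ⟨fun s => (expLift (ContinuousMap.fst.comp (singEquiv _ n q.1)) s + q.2 * (2 * Real.pi),
      (singEquiv _ n q.1 s).2), by fun_prop⟩

theorem singEquiv_deckSimplex (n : ℕ) (x : sing (Circle × Z) _⦋n⦌) (k : ℤ)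
    (s : stdSimplex ℝ (Fin (n + 1))) : singEquiv _ n (deckSimplex Z n (x, k)) s =
      (expLift (ContinuousMap.fst.comp (singEquiv _ n x)) s + k * (2 * Real.pi),
        (singEquiv _ n x s).2) := by
  simp [deckSimplex]

theorem singMap_expProd_deckSimplex (n : ℕ) (x : sing (Circle × Z) _⦋n⦌) (k : ℤ) :
    (singMap (expProd Z)).app _ (deckSimplex Z n (x, k)) = x := by
  rw [singMap_app_eq_iff]
  intro s
  rw [singEquiv_deckSimplex]
  ext1
  · exact (Circle.exp_eq_exp.2 ⟨k, rfl⟩).trans (exp_expLift _ s)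
  · rfl

/-- A simplex is contractible and connected, so its circle coordinate has a lift, unique up to a
multiple of `2π`; the integer is read off at a vertex. -/
theorem deckSimplex_bijective (n : ℕ) : Function.Bijective (deckSimplex Z n) := by
  constructor
  · rintro ⟨x, k⟩ ⟨x', k'⟩ h
    have hx : x = x' := by
      rw [← singMap_expProd_deckSimplex n x k, h, singMap_expProd_deckSimplex]
    subst hx
    have h1 := congrArg Prod.fst (DFunLike.congr_fun (congrArg (singEquiv _ n) h)
      (stdSimplex.vertex 0))
    rw [singEquiv_deckSimplex, singEquiv_deckSimplex] at h1
    simpa [Real.pi_ne_zero] using h1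
  · intro y
    obtain ⟨k, hk⟩ := Circle.exp_lift_unique (X := stdSimplex ℝ (Fin (n + 1)))
      (g := fun s => (singEquiv _ n y s).1)
      (g' := expLift (ContinuousMap.fst.comp (singEquiv _ n ((singMap (expProd Z)).app _ y))))
      (by fun_prop) (by fun_prop) (by
        intro s
        rw [exp_expLift]
        rfl)
    refine ⟨((singMap (expProd Z)).app _ y, k), (singEquiv _ n).injective ?_⟩
    ext1 s
    rw [singEquiv_deckSimplex]
    ext1
    · exact (hk s).symm
    · rfl

theorem singMap_deckTranslation_deckSimplex (n : ℕ) (x : sing (Circle × Z) _⦋n⦌) (k : ℤ) :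
    (singMap (deckTranslation Z)).app _ (deckSimplex Z n (x, k)) = deckSimplex Z n (x, k + 1) := by
  rw [singMap_app_eq_iff]
  intro s
  rw [singEquiv_deckSimplex, singEquiv_deckSimplex]
  ext1
  · simp [deckTranslation]; ring
  · rfl

/-- The rational homology in degree `n` has dimension at most `d`. -/
def HomologyRankLE (X : Type) [TopologicalSpace X] (n d : ℕ) : Prop :=
  Module.Finite ℚ ((sing X).ratHomology n) ∧ Module.finrank ℚ ((sing X).ratHomology n) ≤ d

theorem HomologyRankLE.circle_prod {n a b : ℕ} (ha : HomologyRankLE (ℝ × Z) n a)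
    (hb : HomologyRankLE (ℝ × Z) (n + 1) b) : HomologyRankLE (Circle × Z) (n + 1) (b + a) := by
  have := ha.1
  have := hb.1
  refine (SSet.finrank_homology_le_of_deck (singMap (deckTranslation Z)) (singMap (expProd Z)) ?_
    (fun n => Equiv.ofBijective _ (deckSimplex_bijective n))
    (fun n x k => singMap_deckTranslation_deckSimplex n x k)
    (fun n x k => singMap_expProd_deckSimplex n x k) n).imp id
      (fun h => h.trans (add_le_add hb.2 ha.2))
  rw [← Functor.map_comp]
  congr 1
  ext p
  · exact congrArg Subtype.val (Circle.periodic_exp p.1)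
  · rfl

theorem singularHomology_map_eq {f g : C(X, Y)} (h : f.Homotopic g) (n : ℕ) :
    SSet.homologyMap (singMap f) coeffQ n = SSet.homologyMap (singMap g) coeffQ n := by
  obtain ⟨K⟩ := h
  exact TopCat.Homotopy.congr_homologyMap_singularChainComplexFunctor
    (f := TopCat.ofHom f) (g := TopCat.ofHom g) K coeffQ n

/-- The identity is homotopic to a constant map, which factors through a point. -/
theorem isZero_homology_of_contractible [ContractibleSpace X] (n : ℕ) (hn : n ≠ 0) :
    IsZero ((sing X).ratHomology n) := by
  obtain ⟨x₀, h⟩ := id_nullhomotopic X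
  rw [IsZero.iff_id_eq_zero]
  have h1 := singularHomology_map_eq h n
  have h2 : singMap (ContinuousMap.id X) = 𝟙 _ := CategoryTheory.Functor.map_id _ _
  have h3 : singMap (ContinuousMap.const X x₀) =
      singMap (ContinuousMap.const X PUnit.unit) ≫ singMap (ContinuousMap.const PUnit x₀) :=
    Functor.map_comp TopCat.toSSet (TopCat.ofHom (ContinuousMap.const X PUnit.unit))
      (TopCat.ofHom (ContinuousMap.const PUnit.{1} x₀))
  rw [h2, SSet.homologyMap_id, h3, SSet.homologyMap_comp] at h1
  have h4 : IsZero ((sing PUnit).ratHomology n) :=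
    isZero_singularHomologyFunctor_of_totallyDisconnectedSpace (ModuleCat.{0} ℚ) n coeffQ
      (TopCat.of PUnit) hn
  rw [h1]
  rw [h4.eq_zero_of_tgt (SSet.homologyMap (singMap (ContinuousMap.const X PUnit.unit)) coeffQ n),
    zero_comp]

theorem homologyRankLE_zero (X : Type) [TopologicalSpace X] [PathConnectedSpace X] :
    HomologyRankLE X 0 1 := by
  have : PathConnectedSpace (TopCat.of X) := inferInstanceAs (PathConnectedSpace X)
  have e : (sing X).ratHomology 0 ≃ₗ[ℚ] ℚ :=
    (asIso ((TopCat.of X).singularHomology₀ε coeffQ)).toLinearEquiv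
  exact ⟨Module.Finite.equiv e.symm, by rw [e.finrank_eq, Module.finrank_self]⟩

theorem homologyRankLE_of_contractible (X : Type) [TopologicalSpace X] [ContractibleSpace X]
    (n : ℕ) : HomologyRankLE X (n + 1) 0 := by
  have := ModuleCat.subsingleton_of_isZero (isZero_homology_of_contractible (X := X) (n + 1)
    n.succ_ne_zero)
  exact ⟨inferInstance, Module.finrank_zero_of_subsingleton.le⟩

theorem HomologyRankLE.of_homeomorph {n d : ℕ} (h : HomologyRankLE X n d) (e : X ≃ₜ Y) :
    HomologyRankLE Y n d := by
  have i : (sing X).ratHomology n ≃ₗ[ℚ] (sing Y).ratHomology n :=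
    ((TopCat.toSSet ⋙ SSet.homologyFunctor coeffQ n).mapIso
      (TopCat.isoOfHomeo (X := TopCat.of X) (Y := TopCat.of Y) e)).toLinearEquiv
  have := h.1
  exact ⟨Module.Finite.equiv i, i.finrank_eq ▸ h.2⟩

instance : PathConnectedSpace Circle :=
  Circle.exp_surjective.pathConnectedSpace Circle.exp.continuous

theorem homologyRankLE_real_prod_circle_one : HomologyRankLE (ℝ × Circle) 1 1 :=
  ((homologyRankLE_zero (ℝ × ℝ)).circle_prod
    (homologyRankLE_of_contractible _ 0)).of_homeomorph (Homeomorph.prodComm _ _)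

theorem homologyRankLE_real_prod_circle_two : HomologyRankLE (ℝ × Circle) 2 0 :=
  ((homologyRankLE_of_contractible (ℝ × ℝ) 0).circle_prod
    (homologyRankLE_of_contractible _ 1)).of_homeomorph (Homeomorph.prodComm _ _)

theorem homologyRankLE_torus_zero : HomologyRankLE Torus 0 1 := homologyRankLE_zero _

/-- An upper bound suffices; independent cocycles later force equality. -/
theorem homologyRankLE_torus_one : HomologyRankLE Torus 1 2 :=
  (homologyRankLE_zero (ℝ × Circle)).circle_prod homologyRankLE_real_prod_circle_one

theorem homologyRankLE_torus_two : HomologyRankLE Torus 2 1 :=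
  homologyRankLE_real_prod_circle_one.circle_prod homologyRankLE_real_prod_circle_two

end sing

/-! ### Traces from cocycles and dual cycles -/

/-- The dimension bound turns the surjection `φ` into an isomorphism conjugating `f` to `M`. -/
theorem LinearMap.trace_eq_of_intertwines {V : Type*} [AddCommGroup V] [Module ℚ V]
    [Module.Finite ℚ V] {m : ℕ} (hV : Module.finrank ℚ V ≤ m) (φ : V →ₗ[ℚ] (Fin m → ℚ))
    (hφ : Function.Surjective φ) (f : V →ₗ[ℚ] V) (M : Matrix (Fin m) (Fin m) ℚ)
    (h : ∀ v, φ (f v) = M.mulVec (φ v)) : LinearMap.trace ℚ V f = M.trace := by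
  have hdim : Module.finrank ℚ V = Module.finrank ℚ (Fin m → ℚ) := by
    refine le_antisymm (by simpa using hV) ?_
    rw [← finrank_top ℚ (Fin m → ℚ), ← LinearMap.range_eq_top.2 hφ]
    exact LinearMap.finrank_range_le φ
  let e := LinearEquiv.ofBijective φ
    ⟨(LinearMap.injective_iff_surjective_of_finrank_eq_finrank hdim).2 hφ, hφ⟩
  rw [← LinearMap.trace_conj' f e]
  have : e.conj f = Matrix.toLin' M := by
    ext1 i
    ext1
    simp only [LinearMap.comp_apply, LinearEquiv.conj_apply_apply, Matrix.toLin'_apply]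
    exact (h _).trans (congrArg _ (e.apply_symm_apply _))
  rw [this, Matrix.trace_toLin'_eq]

namespace SSet

variable {X : SSet.{0}}

/-- The linear form on chains attached to a function on simplices. -/
noncomputable def cochain {n : ℕ} (w : X _⦋n⦌ → ℚ) : (X.chainComplex coeffQ).X n ⟶ coeffQ :=
  chainDesc fun x => w x • 𝟙 coeffQ

@[simp]
theorem ι_cochain {n : ℕ} (w : X _⦋n⦌ → ℚ) (x : X _⦋n⦌) :
    X.ιChainComplex x ≫ cochain w = w x • 𝟙 coeffQ :=
  ι_chainDesc _ _

/-- The cocycle condition on functions on simplices. -/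
def IsCocycle {n : ℕ} (w : X _⦋n⦌ → ℚ) : Prop :=
  ∀ y : X _⦋n + 1⦌, ∑ i : Fin (n + 2), (-1) ^ (i : ℕ) * w (X.δ i y) = 0

theorem IsCocycle.d_comp {n : ℕ} {w : X _⦋n⦌ → ℚ} (hw : IsCocycle w) :
    (X.chainComplex coeffQ).d (n + 1) n ≫ cochain w = 0 := by
  apply chainComplex_hom_ext
  intro y
  rw [ιChainComplex_d_assoc, Preadditive.sum_comp, comp_zero]
  have : ∀ i : Fin (n + 2), ((-1 : ℤ) ^ (i : ℕ) • X.ιChainComplex (X.δ i y)) ≫ cochain w =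
      ((-1) ^ (i : ℕ) * w (X.δ i y)) • 𝟙 coeffQ := by
    intro i
    rw [Preadditive.zsmul_comp, ι_cochain, mul_smul]
    rcases neg_one_pow_eq_or ℤ (i : ℕ) with h | h
    · have h' : ((-1 : ℚ)) ^ (i : ℕ) = 1 := by exact_mod_cast congrArg (Int.cast (R := ℚ)) h
      rw [h, h', one_smul, one_smul]
    · have h' : ((-1 : ℚ)) ^ (i : ℕ) = -1 := by exact_mod_cast congrArg (Int.cast (R := ℚ)) h
      rw [h, h', neg_smul, neg_smul, one_smul, one_smul]
  rw [Finset.sum_congr rfl fun i _ => this i, ← Finset.sum_smul, hw y, zero_smul]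

/-- The linear form on opcycles attached to a cocycle. -/
noncomputable def IsCocycle.onOpcycles {n : ℕ} {w : X _⦋n⦌ → ℚ} (hw : IsCocycle w) :
    (X.chainComplex coeffQ).opcycles n ⟶ coeffQ :=
  (X.chainComplex coeffQ).descOpcycles (cochain w) (n + 1) (ChainComplex.prev ℕ n) hw.d_comp

@[simp]
theorem IsCocycle.p_onOpcycles {n : ℕ} {w : X _⦋n⦌ → ℚ} (hw : IsCocycle w) :
    (X.chainComplex coeffQ).pOpcycles n ≫ hw.onOpcycles = cochain w :=
  HomologicalComplex.p_descOpcycles _ _ _ _ _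

/-- The linear form on homology attached to a cocycle. -/
noncomputable def IsCocycle.onHomology {n : ℕ} {w : X _⦋n⦌ → ℚ} (hw : IsCocycle w) :
    X.ratHomology n ⟶ coeffQ :=
  (X.chainComplex coeffQ).homologyι n ≫ hw.onOpcycles

/-- The relation `hM` holds on simplices, not just up to coboundary, so it passes directly to
opcycles and then to homology. -/
theorem IsCocycle.homologyMap_onHomology {n m : ℕ} {w : Fin m → X _⦋n⦌ → ℚ}
    (hw : ∀ i, IsCocycle (w i)) (f : X ⟶ X) (M : Matrix (Fin m) (Fin m) ℚ)
    (hM : ∀ i x, w i (f.app _ x) = ∑ j, M i j * w j x) (i : Fin m) :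
    SSet.homologyMap f coeffQ n ≫ (hw i).onHomology = ∑ j, M i j • (hw j).onHomology := by
  have key : HomologicalComplex.opcyclesMap (chainComplexMap f coeffQ) n ≫ (hw i).onOpcycles =
      ∑ j, M i j • (hw j).onOpcycles := by
    rw [← cancel_epi ((X.chainComplex coeffQ).pOpcycles n),
      HomologicalComplex.p_opcyclesMap_assoc, IsCocycle.p_onOpcycles, Preadditive.comp_sum]
    simp only [Linear.comp_smul, IsCocycle.p_onOpcycles]
    apply chainComplex_hom_ext
    intro x
    rw [ι_chainComplexMap_f_assoc, ι_cochain, hM, Preadditive.comp_sum, Finset.sum_smul]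
    simp only [Linear.comp_smul, ι_cochain, mul_smul]
  rw [IsCocycle.onHomology, HomologicalComplex.homologyι_naturality_assoc, key,
    Preadditive.comp_sum]
  simp only [Linear.comp_smul, IsCocycle.onHomology]

theorem IsCocycle.homologyπ_onHomology {n j : ℕ} {w : X _⦋n⦌ → ℚ} (hw : IsCocycle w)
    (z : coeffQ ⟶ (X.chainComplex coeffQ).X n) (hj : (ComplexShape.down ℕ).next n = j)
    (hz : z ≫ (X.chainComplex coeffQ).d n j = 0) :
    (X.chainComplex coeffQ).liftCycles z j hj hz ≫ (X.chainComplex coeffQ).homologyπ n ≫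
      hw.onHomology = z ≫ cochain w := by
  rw [IsCocycle.onHomology, HomologicalComplex.homology_π_ι_assoc, IsCocycle.p_onOpcycles,
    HomologicalComplex.liftCycles_i_assoc]

/-- The trace on homology, computed from cocycles and dual cycles. -/
theorem trace_homologyMap {n m : ℕ} [Module.Finite ℚ (X.ratHomology n)]
    (hrank : Module.finrank ℚ (X.ratHomology n) ≤ m) {w : Fin m → X _⦋n⦌ → ℚ}
    (hw : ∀ i, IsCocycle (w i)) (f : X ⟶ X) (M : Matrix (Fin m) (Fin m) ℚ)
    (hM : ∀ i x, w i (f.app _ x) = ∑ j, M i j * w j x) {j : ℕ}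
    (hj : (ComplexShape.down ℕ).next n = j)
    (z : Fin m → (coeffQ ⟶ (X.chainComplex coeffQ).X n))
    (hz : ∀ i, z i ≫ (X.chainComplex coeffQ).d n j = 0)
    (hzw : ∀ i k, z i ≫ cochain (w k) = (if i = k then (1 : ℚ) else 0) • 𝟙 coeffQ) :
    LinearMap.trace ℚ (X.ratHomology n) (SSet.homologyMap f coeffQ n).hom = M.trace := by
  let φ : X.ratHomology n →ₗ[ℚ] (Fin m → ℚ) := LinearMap.pi fun i => (hw i).onHomology.hom
  refine LinearMap.trace_eq_of_intertwines hrank φ ?_ _ M ?_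
  · intro v
    -- The classes of the dual cycles are sent by `φ` to the standard basis.
    let c : Fin m → X.ratHomology n := fun i =>
      ((X.chainComplex coeffQ).liftCycles (z i) j hj (hz i) ≫
        (X.chainComplex coeffQ).homologyπ n).hom (1 : ℚ)
    refine ⟨∑ i, v i • c i, ?_⟩
    have hc : ∀ i k, (hw k).onHomology.hom (c i) = if i = k then (1 : ℚ) else 0 := by
      intro i k
      have := ((hw k).homologyπ_onHomology (z i) hj (hz i)).trans (hzw i k)
      rw [← Category.assoc] at this
      have := congrArg (fun q : coeffQ ⟶ coeffQ => q.hom (1 : ℚ)) this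
      refine Eq.trans this ?_
      change (if i = k then (1 : ℚ) else 0) * 1 = _
      rw [mul_one]
    funext k
    simp only [φ, LinearMap.pi_apply, map_sum, map_smul, hc]
    simp
  · intro v
    funext i
    have := congrArg (fun q : X.ratHomology n ⟶ coeffQ => q.hom v)
      (IsCocycle.homologyMap_onHomology hw f M hM i)
    refine Eq.trans this ?_
    simp only [ModuleCat.hom_sum, ModuleCat.hom_smul, LinearMap.sum_apply, LinearMap.smul_apply]
    rfl

end SSet

/-! ### Explicit cocycles and cycles on the torus -/

/-- Lifted simplices have arbitrary real vertices. Such a form makes their coordinates rational,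
turns deck translations into integers, and commutes with integer matrices; continuity is irrelevant.
-/
theorem exists_ratLinear_two_pi : ∃ ρ : ℝ →ₗ[ℚ] ℚ, ρ (2 * Real.pi) = 1 := by
  obtain ⟨ρ, hρ⟩ := Module.Projective.exists_dual_ne_zero ℚ (Real.two_pi_pos.ne')
  exact ⟨(ρ (2 * Real.pi))⁻¹ • ρ, by
    simp only [LinearMap.smul_apply, smul_eq_mul, inv_mul_cancel₀ hρ]⟩

/-- A `ℚ`-linear form on `ℝ` normalized at `2π`. -/
noncomputable def ratForm : ℝ →ₗ[ℚ] ℚ := exists_ratLinear_two_pi.choose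

theorem ratForm_two_pi : ratForm (2 * Real.pi) = 1 := exists_ratLinear_two_pi.choose_spec

theorem ratForm_int_mul (k : ℤ) (x : ℝ) : ratForm (k * x) = k * ratForm x := by
  rw [← zsmul_eq_mul, map_zsmul, zsmul_eq_mul]

/-- `a` is the table of values, under `ratForm`, at the vertices of a lift to `ℝ × ℝ` of a singular
simplex of the torus. -/
def IsVertexLift {n : ℕ} (x : sing Torus _⦋n⦌) (a : Fin 2 → Fin (n + 1) → ℚ) : Prop :=
  ∃ L : Fin 2 → C(stdSimplex ℝ (Fin (n + 1)), ℝ),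
    (∀ s, (Circle.exp (L 0 s), Circle.exp (L 1 s)) = singEquiv Torus n x s) ∧
    ∀ r j, a r j = ratForm (L r (stdSimplex.vertex j))

theorem exists_isVertexLift {n : ℕ} (x : sing Torus _⦋n⦌) : ∃ a, IsVertexLift x a :=
  ⟨_, ![expLift (ContinuousMap.fst.comp (singEquiv Torus n x)),
    expLift (ContinuousMap.snd.comp (singEquiv Torus n x))],
    fun s => Prod.ext (exp_expLift _ s) (exp_expLift _ s), fun _ _ => rfl⟩

/-- Hence differences between vertices do not depend on the lift, and cochains built from them can
be computed with any lift. -/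
theorem IsVertexLift.unique {n : ℕ} {x : sing Torus _⦋n⦌} {a b : Fin 2 → Fin (n + 1) → ℚ}
    (ha : IsVertexLift x a) (hb : IsVertexLift x b) :
    ∃ k : Fin 2 → ℚ, ∀ r j, a r j = b r j + k r := by
  obtain ⟨L, hL, ha⟩ := ha
  obtain ⟨L', hL', hb⟩ := hb
  have h : ∀ r, ∃ k : ℤ, ∀ s, L r s = L' r s + k * (2 * Real.pi) := by
    intro r
    refine Circle.exp_lift_unique (by fun_prop) (by fun_prop) fun s => ?_
    have := Prod.ext_iff.1 ((hL s).trans (hL' s).symm)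
    fin_cases r
    exacts [this.1, this.2]
  choose k hk using h
  refine ⟨fun r => k r, fun r j => ?_⟩
  rw [ha, hb, hk, map_add, ratForm_int_mul, ratForm_two_pi, mul_one]

theorem IsVertexLift.δ {n : ℕ} {x : sing Torus _⦋n + 1⦌} {a : Fin 2 → Fin (n + 2) → ℚ}
    (ha : IsVertexLift x a) (i : Fin (n + 2)) :
    IsVertexLift ((sing Torus).δ i x) fun r j => a r (i.succAbove j) := by
  obtain ⟨L, hL, ha⟩ := ha
  refine ⟨fun r => (L r).comp ⟨stdSimplex.map i.succAbove, stdSimplex.continuous_map _⟩,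
    fun s => ?_, fun r j => ?_⟩
  · rw [singEquiv_δ]
    exact hL _
  · simp [ha]

theorem IsVertexLift.torusAffine {n : ℕ} {x : sing Torus _⦋n⦌} {a : Fin 2 → Fin (n + 1) → ℚ}
    (ha : IsVertexLift x a) (A : Matrix (Fin 2) (Fin 2) ℤ) :
    IsVertexLift ((singMap (torusAffine A 1)).app _ x)
      fun r j => A r 0 * a 0 j + A r 1 * a 1 j := by
  obtain ⟨L, hL, ha⟩ := ha
  refine ⟨fun r => ⟨fun s => A r 0 * L 0 s + A r 1 * L 1 s, by fun_prop⟩, fun s => ?_,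
    fun r j => ?_⟩
  · rw [singEquiv_singMap, ContinuousMap.comp_apply, ← hL s]
    simp [_root_.torusAffine]
  · simp [ha, ratForm_int_mul]

theorem continuous_stdSimplex_sum {n : ℕ} (c : Fin (n + 1) → ℝ) :
    Continuous fun s : stdSimplex ℝ (Fin (n + 1)) => ∑ j, s.1 j * c j :=
  continuous_finsetSum _ fun j _ =>
    ((continuous_apply j).comp continuous_subtype_val).mul continuous_const

/-- The singular simplex of the torus covered by the affine simplex with vertices `2π V`. -/
noncomputable def affineSimplex {n : ℕ} (V : Fin 2 → Fin (n + 1) → ℤ) : sing Torus _⦋n⦌ :=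
  (singEquiv Torus n).symm
    ⟨fun s => (Circle.exp (∑ j, s.1 j * (V 0 j * (2 * Real.pi))),
      Circle.exp (∑ j, s.1 j * (V 1 j * (2 * Real.pi)))),
      (Circle.exp.continuous.comp (continuous_stdSimplex_sum _)).prodMk
        (Circle.exp.continuous.comp (continuous_stdSimplex_sum _))⟩

theorem singEquiv_affineSimplex {n : ℕ} (V : Fin 2 → Fin (n + 1) → ℤ)
    (s : stdSimplex ℝ (Fin (n + 1))) : singEquiv Torus n (affineSimplex V) s =
      (Circle.exp (∑ j, s.1 j * (V 0 j * (2 * Real.pi))),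
        Circle.exp (∑ j, s.1 j * (V 1 j * (2 * Real.pi)))) := by
  simp [affineSimplex]

theorem isVertexLift_affineSimplex {n : ℕ} (V : Fin 2 → Fin (n + 1) → ℤ) :
    IsVertexLift (affineSimplex V) fun r j => V r j := by
  refine ⟨fun r => ⟨fun s => ∑ j, s.1 j * (V r j * (2 * Real.pi)), continuous_stdSimplex_sum _⟩,
    fun s => (singEquiv_affineSimplex V s).symm, fun r j => ?_⟩
  simp [Pi.single_apply, ratForm_int_mul, ratForm_two_pi]

/-- Barycentric coordinates sum to `1`, so the lifts differ by a period. This glues opposite edges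
of the unit square and closes up the cycles below. -/
theorem affineSimplex_eq_of_translate {n : ℕ} {V W : Fin 2 → Fin (n + 1) → ℤ} (k : Fin 2 → ℤ)
    (h : ∀ r j, V r j = W r j + k r) : affineSimplex V = affineSimplex W := by
  apply (singEquiv Torus n).injective
  ext1 s
  rw [singEquiv_affineSimplex, singEquiv_affineSimplex]
  have : ∀ r, Circle.exp (∑ j, s.1 j * (V r j * (2 * Real.pi))) =
      Circle.exp (∑ j, s.1 j * (W r j * (2 * Real.pi))) := by
    intro r
    refine Circle.exp_eq_exp.2 ⟨k r, ?_⟩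
    have hs : ∑ j, s.1 j = 1 := s.2.2
    calc _ = ∑ j, (s.1 j * (W r j * (2 * Real.pi)) + s.1 j * (k r * (2 * Real.pi))) :=
          Finset.sum_congr rfl fun j _ => by rw [h]; push_cast; ring
      _ = _ := by rw [Finset.sum_add_distrib, ← Finset.sum_mul, hs, one_mul]
  rw [this, this]

theorem δ_affineSimplex {n : ℕ} (V : Fin 2 → Fin (n + 2) → ℤ) (i : Fin (n + 2)) :
    (sing Torus).δ i (affineSimplex V) = affineSimplex fun r j => V r (i.succAbove j) := by
  apply (singEquiv Torus n).injective
  ext1 s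
  rw [singEquiv_δ, singEquiv_affineSimplex, ContinuousMap.comp_apply, singEquiv_affineSimplex]
  have : ∀ c : Fin (n + 2) → ℝ, ∑ j, (stdSimplex.map i.succAbove s).1 j * c j =
      ∑ j, s.1 j * c (i.succAbove j) := by
    intro c
    have : ∀ j, (stdSimplex.map i.succAbove s).1 j = ∑ x with i.succAbove x = j, s.1 x := by
      intro j
      exact FunOnFinite.linearMap_apply_apply ..
    simp only [this, Finset.sum_mul]
    rw [← Finset.sum_fiberwise (s := Finset.univ) (g := i.succAbove)]
    refine Finset.sum_congr rfl fun j _ => Finset.sum_congr rfl fun x hx => ?_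
    rw [(Finset.mem_filter.1 hx).2]
  exact Prod.ext (congrArg Circle.exp (this _)) (congrArg Circle.exp (this _))

/-- The winding cocycle of a coordinate of the torus. -/
noncomputable def windingCochain (r : Fin 2) (x : sing Torus _⦋1⦌) : ℚ :=
  (exists_isVertexLift x).choose r 1 - (exists_isVertexLift x).choose r 0

theorem IsVertexLift.windingCochain_eq {x : sing Torus _⦋1⦌} {a : Fin 2 → Fin 2 → ℚ}
    (ha : IsVertexLift x a) (r : Fin 2) : windingCochain r x = a r 1 - a r 0 := by
  obtain ⟨k, hk⟩ := (exists_isVertexLift x).choose_spec.unique ha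
  rw [windingCochain, hk, hk]; ring

/-- The antisymmetrized cup product of the two winding cocycles. -/
noncomputable def areaCochain (x : sing Torus _⦋2⦌) : ℚ :=
  let a := (exists_isVertexLift x).choose
  ((a 0 1 - a 0 0) * (a 1 2 - a 1 1) - (a 1 1 - a 1 0) * (a 0 2 - a 0 1)) / 2

theorem IsVertexLift.areaCochain_eq {x : sing Torus _⦋2⦌} {a : Fin 2 → Fin 3 → ℚ}
    (ha : IsVertexLift x a) : areaCochain x =
      ((a 0 1 - a 0 0) * (a 1 2 - a 1 1) - (a 1 1 - a 1 0) * (a 0 2 - a 0 1)) / 2 := by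
  obtain ⟨k, hk⟩ := (exists_isVertexLift x).choose_spec.unique ha
  simp only [areaCochain, hk]; ring

theorem isCocycle_windingCochain (r : Fin 2) : SSet.IsCocycle (windingCochain r) := by
  intro y
  obtain ⟨a, ha⟩ := exists_isVertexLift y
  simp only [(ha.δ _).windingCochain_eq]
  rw [Fin.sum_univ_three]
  change (-1) ^ 0 * (a r 2 - a r 1) + (-1) ^ 1 * (a r 2 - a r 0) +
    (-1) ^ 2 * (a r 1 - a r 0) = 0
  ring

theorem isCocycle_areaCochain : SSet.IsCocycle areaCochain := by
  intro y
  obtain ⟨a, ha⟩ := exists_isVertexLift y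
  simp only [(ha.δ _).areaCochain_eq]
  rw [Fin.sum_univ_four]
  change (-1) ^ 0 * (((a 0 2 - a 0 1) * (a 1 3 - a 1 2) -
    (a 1 2 - a 1 1) * (a 0 3 - a 0 2)) / 2) +
    (-1) ^ 1 * (((a 0 2 - a 0 0) * (a 1 3 - a 1 2) -
    (a 1 2 - a 1 0) * (a 0 3 - a 0 2)) / 2) +
    (-1) ^ 2 * (((a 0 1 - a 0 0) * (a 1 3 - a 1 1) -
    (a 1 1 - a 1 0) * (a 0 3 - a 0 1)) / 2) +
    (-1) ^ 3 * (((a 0 1 - a 0 0) * (a 1 2 - a 1 1) -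
    (a 1 1 - a 1 0) * (a 0 2 - a 0 1)) / 2) = 0
  ring

/-! ### Traces and Lefschetz number of affine maps -/

theorem trace_torusAffine_zero (A : Matrix (Fin 2) (Fin 2) ℤ) :
    LinearMap.trace ℚ _ (inducedOnHomology 0 (torusAffine A 1)) = 1 := by
  have := homologyRankLE_torus_zero.1
  have h := SSet.trace_homologyMap (X := sing Torus) (n := 0) (m := 1) homologyRankLE_torus_zero.2
    (w := fun _ _ => 1) (by intro i y; simp [Fin.sum_univ_succ]) (singMap (torusAffine A 1)) 1
    (by simp) ChainComplex.next_nat_zero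
    (fun _ => (sing Torus).ιChainComplex (affineSimplex 0))
    (by simp) (by intro i k; rw [SSet.ι_cochain, if_pos (Subsingleton.elim _ _)])
  exact h.trans (by simp)

theorem trace_torusAffine_one (A : Matrix (Fin 2) (Fin 2) ℤ) :
    LinearMap.trace ℚ _ (inducedOnHomology 1 (torusAffine A 1)) = A.trace := by
  have := homologyRankLE_torus_one.1
  have h := SSet.trace_homologyMap (X := sing Torus) (n := 1) (m := 2) homologyRankLE_torus_one.2
    isCocycle_windingCochain (singMap (torusAffine A 1)) (A.map (Int.cast (R := ℚ)))
    (by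
      intro i x
      obtain ⟨a, ha⟩ := exists_isVertexLift x
      rw [(ha.torusAffine A).windingCochain_eq]
      simp only [Fin.sum_univ_two, ha.windingCochain_eq, Matrix.map_apply]
      ring) (ChainComplex.next_nat_succ 0)
    -- The `i`-th coordinate loop, covered by the segment from `0` to the `i`-th unit vector.
    (fun i => (sing Torus).ιChainComplex (affineSimplex fun r j => if i = r ∧ j = 1 then 1 else 0))
    (by
      intro i
      rw [SSet.ιChainComplex_d]
      simp only [δ_affineSimplex]
      rw [Fin.sum_univ_two, affineSimplex_eq_of_translate (fun r => if i = r then 1 else 0)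
        (W := fun r j => if i = r ∧ (1 : Fin 2).succAbove j = 1 then 1 else 0)]
      · simp
      · intro r j
        fin_cases j
        simp [Fin.succAbove])
    (by
      intro i k
      rw [SSet.ι_cochain, (isVertexLift_affineSimplex _).windingCochain_eq]
      simp)
  exact h.trans (by simp [Matrix.trace])

theorem trace_torusAffine_two (A : Matrix (Fin 2) (Fin 2) ℤ) :
    LinearMap.trace ℚ _ (inducedOnHomology 2 (torusAffine A 1)) = A.det := by
  have := homologyRankLE_torus_two.1
  have h := SSet.trace_homologyMap (X := sing Torus) (n := 2) (m := 1) homologyRankLE_torus_two.2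
    (w := fun _ => areaCochain) (fun _ => isCocycle_areaCochain) (singMap (torusAffine A 1))
    (Matrix.of fun _ _ => (A.det : ℚ))
    (by
      intro i x
      obtain ⟨a, ha⟩ := exists_isVertexLift x
      -- Antisymmetrization makes the cochain an alternating form in two edge vectors, so `A` scales
      -- it exactly by `det A`.
      rw [(ha.torusAffine A).areaCochain_eq]
      simp only [Fin.sum_univ_one, ha.areaCochain_eq, Matrix.det_fin_two, Matrix.of_apply]
      push_cast
      ring) (ChainComplex.next_nat_succ 1)
    -- The unit square cut along its diagonal. The triangles are oppositely oriented, hence the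
    -- minus sign; their signed areas `1/2` and `-1/2` then give total `1`.
    (fun _ => (sing Torus).ιChainComplex (affineSimplex ![![0, 1, 1], ![0, 0, 1]]) -
      (sing Torus).ιChainComplex (affineSimplex ![![0, 0, 1], ![0, 1, 1]]))
    (by
      intro i
      rw [Preadditive.sub_comp, SSet.ιChainComplex_d, SSet.ιChainComplex_d]
      simp only [δ_affineSimplex]
      rw [Fin.sum_univ_three, Fin.sum_univ_three, affineSimplex_eq_of_translate ![1, 0]
          (V := fun r j => (![![0, 1, 1], ![0, 0, 1]] : Fin 2 → Fin 3 → ℤ) r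
            ((0 : Fin 3).succAbove j))
          (W := fun r j => (![![0, 0, 1], ![0, 1, 1]] : Fin 2 → Fin 3 → ℤ) r
            ((2 : Fin 3).succAbove j)) (by decide),
        affineSimplex_eq_of_translate ![0, -1]
          (V := fun r j => (![![0, 1, 1], ![0, 0, 1]] : Fin 2 → Fin 3 → ℤ) r
            ((2 : Fin 3).succAbove j))
          (W := fun r j => (![![0, 0, 1], ![0, 1, 1]] : Fin 2 → Fin 3 → ℤ) r
            ((0 : Fin 3).succAbove j)) (by decide),
        affineSimplex_eq_of_translate 0
          (V := fun r j => (![![0, 1, 1], ![0, 0, 1]] : Fin 2 → Fin 3 → ℤ) r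
            ((1 : Fin 3).succAbove j))
          (W := fun r j => (![![0, 0, 1], ![0, 1, 1]] : Fin 2 → Fin 3 → ℤ) r
            ((1 : Fin 3).succAbove j)) (by decide)]
      simp
      abel)
    (by
      intro i k
      rw [Preadditive.sub_comp, SSet.ι_cochain, SSet.ι_cochain,
        (isVertexLift_affineSimplex _).areaCochain_eq,
        (isVertexLift_affineSimplex _).areaCochain_eq, if_pos (Subsingleton.elim _ _), ← sub_smul]
      refine congrArg (fun q : ℚ => q • 𝟙 coeffQ) ?_
      change ((((1 : ℤ) : ℚ) - (0 : ℤ)) * (((1 : ℤ) : ℚ) - (0 : ℤ)) -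
        (((0 : ℤ) : ℚ) - (0 : ℤ)) * (((1 : ℤ) : ℚ) - (1 : ℤ))) / 2 -
        ((((0 : ℤ) : ℚ) - (0 : ℤ)) * (((1 : ℤ) : ℚ) - (1 : ℤ)) -
        (((1 : ℤ) : ℚ) - (0 : ℤ)) * (((1 : ℤ) : ℚ) - (0 : ℤ))) / 2 = 1
      norm_num)
  exact h.trans (by simp [Matrix.trace])

theorem lefschetzNumber_torusAffine (A : Matrix (Fin 2) (Fin 2) ℤ) :
    lefschetzNumber (torusAffine A 1) = ((1 - A).det : ℤ) := by
  simp only [lefschetzNumber, Finset.sum_range_succ, Finset.sum_range_zero,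
    trace_torusAffine_zero, trace_torusAffine_one, trace_torusAffine_two]
  simp [Matrix.det_fin_two, Matrix.trace]
  ring

theorem lefschetzNumber_eq_of_homotopic {f g : C(Torus, Torus)} (h : f.Homotopic g) :
    lefschetzNumber f = lefschetzNumber g := by
  have : ∀ k, inducedOnHomology k f = inducedOnHomology k g := fun k =>
    congrArg ModuleCat.Hom.hom (singularHomology_map_eq h k)
  simp only [lefschetzNumber, this]

/-! ### Removing the fixed points -/

theorem homotopic_timeSlice_comp_torusProj (F : C(Torus × I, Torus)) :
    F.Homotopic ((timeSlice F 0).comp torusProj) :=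
  ⟨⟨⟨fun q => F (q.2.1, unitInterval.symm q.1 * q.2.2), by fun_prop⟩,
    fun p => by simp, fun p => by simp [timeSlice, torusProj]⟩⟩

theorem ContMDiff.circle_zpow {E H M : Type*} [NormedAddCommGroup E] [NormedSpace ℝ E]
    [TopologicalSpace H] {J : ModelWithCorners ℝ E H} [TopologicalSpace M] [ChartedSpace H M]
    {f : M → Circle} (hf : ContMDiff J (𝓡 1) ∞ f) (k : ℤ) :
    ContMDiff J (𝓡 1) ∞ fun x => f x ^ k := by
  cases k with
  | ofNat n => simpa using hf.pow n
  | negSucc n => simpa using (hf.pow (n + 1)).inv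

theorem contMDiff_torusAffine (A : Matrix (Fin 2) (Fin 2) ℤ) (c : Torus) :
    ContMDiff torusModel torusModel ∞ (torusAffine A c) := by
  have h1 : ContMDiff torusModel (𝓡 1) ∞ (Prod.fst : Torus → Circle) := contMDiff_fst
  have h2 : ContMDiff torusModel (𝓡 1) ∞ (Prod.snd : Torus → Circle) := contMDiff_snd
  exact (((h1.circle_zpow _).mul (h2.circle_zpow _)).mul contMDiff_const).prodMk
    (((h1.circle_zpow _).mul (h2.circle_zpow _)).mul contMDiff_const)

/-- If `A` has eigenvalue `1`, some affine map with linear part `A` has no fixed point: an integral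
left eigenvector `v` gives a character `χ` with `χ (A x + c) = χ x + χ c`. -/
theorem exists_torusAffine_fixedPointFree (A : Matrix (Fin 2) (Fin 2) ℤ) (hA : (1 - A).det = 0) :
    ∃ c : Torus, ∀ x, torusAffine A c x ≠ x := by
  obtain ⟨v, hv, hvA⟩ := Matrix.exists_vecMul_eq_zero_iff.2 hA
  have e0 : v 0 * A 0 0 + v 1 * A 1 0 = v 0 := by
    have := congrFun hvA 0
    simp [Matrix.vecMul, dotProduct, Fin.sum_univ_two] at this
    linarith
  have e1 : v 0 * A 0 1 + v 1 * A 1 1 = v 1 := by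
    have := congrFun hvA 1
    simp [Matrix.vecMul, dotProduct, Fin.sum_univ_two] at this
    linarith
  obtain ⟨c, hc⟩ : ∃ c : Torus, c.1 ^ v 0 * c.2 ^ v 1 ≠ 1 := by
    -- The power is `exp (iπ) = -1`.
    have hpi : ∀ k : ℤ, k ≠ 0 → Circle.exp (Real.pi / k) ^ k ≠ 1 := by
      intro k hk
      have hk' : (k : ℝ) ≠ 0 := by exact_mod_cast hk
      rw [← Circle.exp_intCast_mul, mul_div_cancel₀ _ hk']
      exact Circle.exp_pi_ne_one
    rcases eq_or_ne (v 0) 0 with h0 | h0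
    · have h1 : v 1 ≠ 0 := fun h1 => hv (by ext i; fin_cases i <;> assumption)
      exact ⟨(1, Circle.exp (Real.pi / v 1)), by simpa using hpi _ h1⟩
    · exact ⟨(Circle.exp (Real.pi / v 0), 1), by simpa using hpi _ h0⟩
  refine ⟨c, fun x hx => hc ?_⟩
  obtain ⟨h1, h2⟩ := Prod.ext_iff.1 hx
  change x.1 ^ A 0 0 * x.2 ^ A 0 1 * c.1 = x.1 at h1
  change x.1 ^ A 1 0 * x.2 ^ A 1 1 * c.2 = x.2 at h2
  -- At a fixed point this reads `χ(x) χ(c) = χ(x)`, forcing `χ(c) = 1`.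
  have key : x.1 ^ v 0 * x.2 ^ v 1 * (c.1 ^ v 0 * c.2 ^ v 1) = x.1 ^ v 0 * x.2 ^ v 1 := by
    calc _ = (x.1 ^ A 0 0 * x.2 ^ A 0 1 * c.1) ^ v 0 * (x.1 ^ A 1 0 * x.2 ^ A 1 1 * c.2) ^ v 1 := by
          have p0 : x.1 ^ v 0 = x.1 ^ (A 0 0 * v 0) * x.1 ^ (A 1 0 * v 1) := by
            rw [← zpow_add, mul_comm, mul_comm (A 1 0), e0]
          have p1 : x.2 ^ v 1 = x.2 ^ (A 0 1 * v 0) * x.2 ^ (A 1 1 * v 1) := by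
            rw [← zpow_add, mul_comm, mul_comm (A 1 1), e1]
          rw [p0, p1]
          simp only [mul_zpow, ← zpow_mul]
          ac_rfl
      _ = _ := by rw [h1, h2]
  exact mul_eq_left.1 key

theorem proposition4p1 (F : C(Torus × unitInterval, Torus))
    (hF : ∀ t : unitInterval, lefschetzNumber (timeSlice F t) = 0) :
    ∃ H : C(Torus × unitInterval, Torus),
      F.Homotopic H ∧
      TransverseGraphs H torusProj ∧
      (∀ t : unitInterval, (fixSet H ∩ {p | p.2 = t}).Finite) ∧
      (∀ p ∈ fixSet H, p.2 ≠ 0 ∧ p.2 ≠ 1) := by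
  obtain ⟨A, hA⟩ := exists_homotopic_torusAffine (timeSlice F 0)
  have hdet : (1 - A).det = 0 := by
    have h := hF 0
    rw [lefschetzNumber_eq_of_homotopic (hA 1), lefschetzNumber_torusAffine] at h
    exact_mod_cast h
  obtain ⟨c, hc⟩ := exists_torusAffine_fixedPointFree A hdet
  have hfix : ∀ p, (torusAffine A c).comp torusProj p ≠ torusProj p := fun p => hc p.1
  have hempty : fixSet ((torusAffine A c).comp torusProj) = ∅ :=
    Set.eq_empty_iff_forall_notMem.2 hfix
  have hproj : ContMDiff torusIntervalModel torusModel ∞ torusProj := contMDiff_fst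
  -- The two graphs are disjoint, so transversality reduces to smoothness of the graph maps.
  refine ⟨(torusAffine A c).comp torusProj,
    (homotopic_timeSlice_comp_torusProj F).trans ((hA c).comp (.refl _)),
    ⟨contMDiff_id.prodMk ((contMDiff_torusAffine A c).comp hproj), contMDiff_id.prodMk hproj,
      fun a b hab => ?_⟩, fun t => by simp [hempty], fun p hp => absurd hp (hfix p)⟩
  obtain ⟨rfl, h⟩ := Prod.ext_iff.1 hab
  exact absurd h (hfix _)
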